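/- Let $E_1,E_2$ be Hausdorff locally convex real topological vector spaces, and let $S_1\subseteq E_1$, $S_2\subseteq E_2$ be compact metrizable Choquet simplices. (A compact convex set $S\subseteq E$ is a Choquet simplex if, with $K=\{(tx,t): t\ge 0,\ x\in S\}\subseteq E\times\mathbb R$, the vector space $K-K$ ordered by $u\le v\iff v-u\in K$ is a lattice.) Let $F:S_1\times S_2\to\mathbb R$ be continuous, strictly positive and biaffine, i.e. affine in each variable separately. Then $F$ can be approximated uniformly from below by finite sums of products of positive continuous affine functions: for every $\varepsilon>0$ there are $m,n\in\mathbb N$, scalars $a_{ij}>0$, strictly positive continuous affine functions $f_1,\dots,f_m$ on $S_1$ and strictly positive continuous affine functions $g_1,\dots,g_n$ on $S_2$ such that, for all $(x,y)\in S_1\times S_2$, $$F(x,y)-\varepsilon<\sum_{i=1}^m\sum_{j=1}^n a_{ij}f_i(x)g_j(y)\le F(x,y).$$ -/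

import Mathlib

open scoped Pointwise

/-- The cone `{(t x, t) : t ≥ 0, x ∈ S}` in `E × ℝ`, which has (a copy of) `S` as its base at
height `1`. -/
def coneOver {E : Type*} [AddCommGroup E] [Module ℝ E] (S : Set E) : Set (E × ℝ) :=
  {p | ∃ t : ℝ, 0 ≤ t ∧ ∃ x ∈ S, p = (t • x, t)}

/-- A subset `S` of a topological vector space is a (compact) Choquet simplex if it is compact
and convex, and the vector space `K - K` spanned by the cone `K` over `S` is a lattice for the
order `u ≤ v ↔ v - u ∈ K`: any two elements `a, b` have a least upper bound `s`
(greatest lower bounds follow, by passing to negatives). -/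
structure IsChoquetSimplex {E : Type*} [AddCommGroup E] [Module ℝ E] [TopologicalSpace E]
    (S : Set E) : Prop where
  isCompact : IsCompact S
  convex : Convex ℝ S
  exists_sup : ∀ a ∈ coneOver S - coneOver S, ∀ b ∈ coneOver S - coneOver S,
    ∃ s ∈ coneOver S - coneOver S, s - a ∈ coneOver S ∧ s - b ∈ coneOver S ∧
      ∀ u ∈ coneOver S - coneOver S, u - a ∈ coneOver S → u - b ∈ coneOver S →
        u - s ∈ coneOver S

/-- `f` is affine on the (convex) set `S`: it preserves convex combinations of points of `S`. -/
def IsAffineOn {E : Type*} [AddCommGroup E] [Module ℝ E] (S : Set E) (f : E → ℝ) : Prop :=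
  ∀ x ∈ S, ∀ y ∈ S, ∀ s t : ℝ, 0 ≤ s → 0 ≤ t → s + t = 1 →
    f (s • x + t • y) = s * f x + t * f y

/-! Shift `F` down by a small constant `θ` and sample it in the second variable: `F(x, y) - θ ≈ ∑ j,
(F(x, v j) - θ) * g j y`, with finitely many points `v j` of `S₂` and positive continuous affine `g
j`. For fixed `y`, nearly all the weight on a `v j` close to `y` works. Nets in both variables turn
the requirement on `g` into finitely many strict linear inequalities, solvable at each `y`.

On a simplex, pointwise solvability gives a continuous affine solution (`exists_affine_solution`):
eliminate unknowns as in Fourier–Motzkin, then recover each one by strict interpolation between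
affine lower and upper bounds (`exists_between`). Interpolation is Hahn–Banach separation of the
convex hulls of the graphs; these do not meet because the lattice order on the cone yields Riesz
decomposition. A small perturbation then makes all coefficients positive, and `θ` absorbs the
errors. -/

/-! ### The cone over `S` and homogeneous extensions. -/

section Cone

variable {E : Type*} [AddCommGroup E] [Module ℝ E] {S : Set E}

theorem mem_coneOver_smul {x : E} (hx : x ∈ S) {t : ℝ} (ht : 0 ≤ t) :
    (t • x, t) ∈ coneOver S := ⟨t, ht, x, hx, rfl⟩

theorem zero_mem_coneOver (hne : S.Nonempty) : (0 : E × ℝ) ∈ coneOver S := by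
  obtain ⟨x, hx⟩ := hne
  exact ⟨0, le_rfl, x, hx, by simp; rfl⟩

theorem snd_nonneg_of_mem_coneOver {p : E × ℝ} (hp : p ∈ coneOver S) : 0 ≤ p.2 := by
  obtain ⟨t, ht, x, -, rfl⟩ := hp
  exact ht

theorem eq_zero_of_mem_coneOver_of_neg_mem {x : E × ℝ} (hx : x ∈ coneOver S)
    (hx' : -x ∈ coneOver S) : x = 0 := by
  have h1 := snd_nonneg_of_mem_coneOver hx'
  obtain ⟨t, ht, y, -, rfl⟩ := hx
  have : t = 0 := le_antisymm (by simpa using h1) ht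
  simp [this]

theorem smul_mem_coneOver {p : E × ℝ} (hp : p ∈ coneOver S) {s : ℝ} (hs : 0 ≤ s) :
    s • p ∈ coneOver S := by
  obtain ⟨t, ht, x, hx, rfl⟩ := hp
  exact ⟨s * t, mul_nonneg hs ht, x, hx, by simp [mul_smul]⟩

theorem add_mem_coneOver (hS : Convex ℝ S) {p q : E × ℝ} (hp : p ∈ coneOver S)
    (hq : q ∈ coneOver S) : p + q ∈ coneOver S := by
  obtain ⟨s, hs, x, hx, rfl⟩ := hp
  obtain ⟨t, ht, y, hy, rfl⟩ := hq
  rcases eq_or_lt_of_le (add_nonneg hs ht) with h | h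
  · have hs0 : s = 0 := by linarith
    have ht0 : t = 0 := by linarith
    exact ⟨0, le_rfl, x, hx, by simp [hs0, ht0]⟩
  · refine ⟨s + t, h.le, (s / (s + t)) • x + (t / (s + t)) • y,
      hS hx hy (by positivity) (by positivity) (by field_simp), ?_⟩
    ext
    · simp only [Prod.fst_add, smul_add, smul_smul]
      rw [mul_div_cancel₀ _ h.ne', mul_div_cancel₀ _ h.ne']
    · simp

/-- The cone over a nonempty convex set, as an additive submonoid. -/
def coneOverSubmonoid (S : Set E) (hS : Convex ℝ S) (hne : S.Nonempty) :
    AddSubmonoid (E × ℝ) where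
  carrier := coneOver S
  zero_mem' := zero_mem_coneOver hne
  add_mem' := add_mem_coneOver hS

/-- The positively homogeneous extension of a function on `S` to the cone over `S`. -/
noncomputable def coneExtend (f : E → ℝ) (p : E × ℝ) : ℝ := p.2 * f (p.2⁻¹ • p.1)

theorem coneExtend_smul (f : E → ℝ) (t : ℝ) (x : E) : coneExtend f (t • x, t) = t * f x := by
  -- At the apex the factor `t = 0` cancels the arbitrary value of `f` at `0⁻¹ • 0`.
  rcases eq_or_ne t 0 with rfl | ht
  · simp [coneExtend]
  · simp [coneExtend, smul_smul, ht]

theorem coneExtend_const_smul (f : E → ℝ) {p : E × ℝ} (hp : p ∈ coneOver S) (s : ℝ) :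
    coneExtend f (s • p) = s * coneExtend f p := by
  obtain ⟨t, ht, x, hx, rfl⟩ := hp
  have : s • (t • x, t) = ((s * t) • x, s * t) := by simp [mul_smul]
  rw [this, coneExtend_smul, coneExtend_smul, mul_assoc]

theorem coneExtend_add {f : E → ℝ} (hf : IsAffineOn S f) {p q : E × ℝ} (hp : p ∈ coneOver S)
    (hq : q ∈ coneOver S) : coneExtend f (p + q) = coneExtend f p + coneExtend f q := by
  obtain ⟨s, hs, x, hx, rfl⟩ := hp
  obtain ⟨t, ht, y, hy, rfl⟩ := hq
  rcases eq_or_lt_of_le (add_nonneg hs ht) with h | h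
  · have hs0 : s = 0 := by linarith
    have ht0 : t = 0 := by linarith
    simp [hs0, ht0, coneExtend]
  · have h1 := hf x hx y hy (s / (s + t)) (t / (s + t)) (by positivity) (by positivity)
      (by field_simp)
    have h2 : (s • x, s) + (t • y, t) =
        ((s + t) • ((s / (s + t)) • x + (t / (s + t)) • y), s + t) := by
      ext
      · simp only [Prod.fst_add, smul_add, smul_smul]
        rw [mul_div_cancel₀ _ h.ne', mul_div_cancel₀ _ h.ne']
      · simp
    rw [h2, coneExtend_smul, coneExtend_smul, coneExtend_smul, h1]
    field_simp

theorem coneExtend_sum {f : E → ℝ} (hf : IsAffineOn S f) (hS : Convex ℝ S) (hne : S.Nonempty)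
    {ι : Type*} (s : Finset ι) (p : ι → E × ℝ) (hp : ∀ i ∈ s, p i ∈ coneOver S) :
    coneExtend f (∑ i ∈ s, p i) = ∑ i ∈ s, coneExtend f (p i) := by
  classical
  induction s using Finset.induction_on with
  | empty => simp [coneExtend]
  | insert a s ha ih =>
    rw [Finset.sum_insert ha, Finset.sum_insert ha, coneExtend_add hf (hp a (by simp)),
      ih fun i hi => hp i (by simp [hi])]
    exact (coneOverSubmonoid S hS hne).sum_mem fun i hi => hp i (by simp [hi])

end Cone

/-! ### Riesz decomposition and refinement. -/

section Riesz

/-- The Riesz decomposition property of the order with positive cone `K`. -/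
def HasRieszDecomposition {V : Type*} [AddCommGroup V] (K : AddSubmonoid V) : Prop :=
  ∀ u ∈ K, ∀ v ∈ K, ∀ w ∈ K, v + w - u ∈ K →
    ∃ u₁ ∈ K, ∃ u₂ ∈ K, u₁ + u₂ = u ∧ v - u₁ ∈ K ∧ w - u₂ ∈ K

variable {V : Type*} [AddCommGroup V] {K : AddSubmonoid V} {ι κ : Type*}

theorem HasRieszDecomposition.exists_sum_eq (hK : HasRieszDecomposition K) (t : Finset κ)
    (v : κ → V) (hv : ∀ j ∈ t, v j ∈ K) (u : V) (hu : u ∈ K) (huv : ∑ j ∈ t, v j - u ∈ K)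
    (hpointed : ∀ x ∈ K, -x ∈ K → x = 0) :
    ∃ c : κ → V, (∀ j ∈ t, c j ∈ K ∧ v j - c j ∈ K) ∧ ∑ j ∈ t, c j = u := by
  classical
  induction t using Finset.induction_on generalizing u with
  | empty =>
    refine ⟨0, by simp, ?_⟩
    rw [hpointed u hu (by simpa using huv)]
    simp
  | insert a t ha ih =>
    rw [Finset.sum_insert ha] at huv
    have ht : ∀ j ∈ t, v j ∈ K := fun j hj => hv j (by simp [hj])
    obtain ⟨u₁, hu₁, u₂, hu₂, rfl, h₁, h₂⟩ :=
      hK u hu (v a) (hv a (by simp)) _ (K.sum_mem ht) huv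
    obtain ⟨c, hc, hcs⟩ := ih ht u₂ hu₂ h₂
    have hne : ∀ j ∈ t, j ≠ a := fun j hj h => ha (h ▸ hj)
    refine ⟨Function.update c a u₁, ?_, ?_⟩
    · intro j hj
      rcases Finset.mem_insert.1 hj with rfl | hj
      · simp [hu₁, h₁]
      · simpa [hne j hj] using hc j hj
    · rw [Finset.sum_insert ha, Function.update_self, ← hcs]
      congr 1
      exact Finset.sum_congr rfl fun j hj => Function.update_of_ne (hne j hj) _ _

/-- Row by row: `u a` lies below `∑ v j`, so it splits into pieces `d j ≤ v j`; the remaining rows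
refine `v - d`. -/
theorem HasRieszDecomposition.exists_refinement (hK : HasRieszDecomposition K)
    (hpointed : ∀ x ∈ K, -x ∈ K → x = 0) (s : Finset ι) (t : Finset κ)
    (u : ι → V) (v : κ → V) (hu : ∀ i ∈ s, u i ∈ K) (hv : ∀ j ∈ t, v j ∈ K)
    (huv : ∑ i ∈ s, u i = ∑ j ∈ t, v j) :
    ∃ c : ι → κ → V, (∀ i ∈ s, ∀ j ∈ t, c i j ∈ K) ∧ (∀ i ∈ s, ∑ j ∈ t, c i j = u i) ∧
      ∀ j ∈ t, ∑ i ∈ s, c i j = v j := by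
  classical
  induction s using Finset.induction_on generalizing v with
  | empty =>
    refine ⟨0, by simp, by simp, fun j hj => ?_⟩
    simp only [Finset.sum_empty] at huv ⊢
    refine (hpointed _ (hv j hj) ?_).symm
    have : -v j = ∑ i ∈ t.erase j, v i := by
      rw [← Finset.add_sum_erase t v hj] at huv
      exact (eq_neg_of_add_eq_zero_right huv.symm).symm
    rw [this]
    exact K.sum_mem fun i hi => hv i (Finset.mem_of_mem_erase hi)
  | insert a s ha ih =>
    rw [Finset.sum_insert ha] at huv
    have hs : ∀ i ∈ s, u i ∈ K := fun i hi => hu i (by simp [hi])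
    obtain ⟨d, hd, hds⟩ := hK.exists_sum_eq t v hv (u a) (hu a (by simp))
      (by rw [← huv, add_sub_cancel_left]; exact K.sum_mem hs) hpointed
    obtain ⟨c, hc, hcu, hcv⟩ := ih (fun j => v j - d j) hs (fun j hj => (hd j hj).2)
      (by rw [Finset.sum_sub_distrib, hds, ← huv, add_sub_cancel_left])
    have hne : ∀ i ∈ s, i ≠ a := fun i hi h => ha (h ▸ hi)
    refine ⟨Function.update c a d, ?_, ?_, ?_⟩
    · intro i hi j hj
      rcases Finset.mem_insert.1 hi with rfl | hi
      · simpa using (hd j hj).1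
      · simpa [hne i hi] using hc i hi j hj
    · intro i hi
      rcases Finset.mem_insert.1 hi with rfl | hi
      · simpa using hds
      · simpa [hne i hi] using hcu i hi
    · intro j hj
      rw [Finset.sum_insert ha, Function.update_self]
      rw [Finset.sum_congr rfl fun i hi => by rw [Function.update_of_ne (hne i hi)], hcv j hj]
      abel

end Riesz

/-! ### Riesz decomposition from the lattice order. -/

section Simplex

variable {E : Type*} [AddCommGroup E] [Module ℝ E] [TopologicalSpace E] {S : Set E}

theorem IsChoquetSimplex.hasRieszDecomposition (hS : IsChoquetSimplex S) (hne : S.Nonempty) :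
    HasRieszDecomposition (coneOverSubmonoid S hS.convex hne) := by
  intro u hu v hv w hw huvw
  change u ∈ coneOver S at hu
  change v ∈ coneOver S at hv
  change w ∈ coneOver S at hw
  have h0 : (0 : E × ℝ) ∈ coneOver S := zero_mem_coneOver hne
  have hneg : ∀ p ∈ coneOver S, -p ∈ coneOver S - coneOver S := fun p hp =>
    ⟨0, h0, p, hp, by simp⟩
  -- Here `-s` is the infimum of `u` and `v`, the largest part of `u` that fits under `v`. The rest
  -- fits under `w` because `w - u` is an upper bound of `-u` and `-v`.
  obtain ⟨s, -, hsu, hsv, hs⟩ := hS.exists_sup _ (hneg u hu) _ (hneg v hv)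
  refine ⟨-s, ?_, u + s, ?_, by abel, ?_, ?_⟩
  · have := hs 0 ⟨0, h0, 0, h0, by simp⟩ (by simpa using hu) (by simpa using hv)
    rwa [zero_sub] at this
  · rwa [sub_neg_eq_add, add_comm] at hsu
  · rw [sub_neg_eq_add, add_comm] at hsv ⊢
    exact add_comm s v ▸ hsv
  · have := hs (w - u) ⟨w, hw, u, hu, rfl⟩ (by simpa using hw)
      (by rw [show w - u - -v = v + w - u by abel]; exact huvw)
    rwa [sub_sub] at this

end Simplex

/-! ### Convex hulls of graphs. -/

section GraphHull

variable {E : Type*} [AddCommGroup E] [Module ℝ E] {S : Set E} {ι : Type*} [Fintype ι]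

/-- The convex hull in `E × ℝ` of the graphs over `S` of finitely many affine functions,
parametrized by the cone over `S`. -/
def graphHull (S : Set E) (h : ι → E → ℝ) : Set (E × ℝ) :=
  {q | ∃ p : ι → E × ℝ, (∀ i, p i ∈ coneOver S) ∧ ∑ i, (p i).2 = 1 ∧
    q = (∑ i, (p i).1, ∑ i, coneExtend (h i) (p i))}

theorem convex_graphHull (hS : Convex ℝ S) {h : ι → E → ℝ} (hh : ∀ i, IsAffineOn S (h i)) :
    Convex ℝ (graphHull S h) := by
  rintro _ ⟨p, hp, hp1, rfl⟩ _ ⟨q, hq, hq1, rfl⟩ s t hs ht hst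
  refine ⟨fun i => s • p i + t • q i, fun i => add_mem_coneOver hS
    (smul_mem_coneOver (hp i) hs) (smul_mem_coneOver (hq i) ht), ?_, ?_⟩
  · simp [Finset.sum_add_distrib, ← Finset.mul_sum, hp1, hq1, hst]
  · ext
    · simp [Finset.sum_add_distrib, Finset.smul_sum]
    · simp only [Prod.snd_add, Prod.smul_snd, smul_eq_mul, Finset.mul_sum,
        ← Finset.sum_add_distrib]
      refine Finset.sum_congr rfl fun i _ => ?_
      rw [coneExtend_add (hh i) (smul_mem_coneOver (hp i) hs) (smul_mem_coneOver (hq i) ht),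
        coneExtend_const_smul _ (hp i), coneExtend_const_smul _ (hq i)]

theorem mem_graphHull {h : ι → E → ℝ} {x : E} (hx : x ∈ S) (i : ι) :
    (x, h i x) ∈ graphHull S h := by
  classical
  refine ⟨fun j => ((Pi.single i (1 : ℝ) : ι → ℝ) j • x, (Pi.single i (1 : ℝ) : ι → ℝ) j),
    fun j => mem_coneOver_smul hx ?_, by simp, ?_⟩
  · rcases eq_or_ne j i with rfl | hj <;> simp [*]
  · simp only [coneExtend_smul, ← Finset.sum_smul]
    simp [Pi.single_apply]

/-- Writing cone points as weight times point exhibits the hull as a continuous image of `stdSimplex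
ℝ ι` times a power of `S`. -/
theorem isCompact_graphHull [TopologicalSpace E] [IsTopologicalAddGroup E]
    [ContinuousSMul ℝ E] (hS : IsCompact S) {h : ι → E → ℝ} (hh : ∀ i, ContinuousOn (h i) S) :
    IsCompact (graphHull S h) := by
  have h1 : IsCompact ((stdSimplex ℝ ι) ×ˢ (Set.univ.pi fun _ : ι => S)) :=
    (isCompact_stdSimplex ℝ ι).prod (isCompact_univ_pi fun _ => hS)
  have h2 : ContinuousOn
      (fun q : (ι → ℝ) × (ι → E) => (∑ i, q.1 i • q.2 i, ∑ i, q.1 i * h i (q.2 i)))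
      ((stdSimplex ℝ ι) ×ˢ (Set.univ.pi fun _ : ι => S)) := by
    refine ContinuousOn.prodMk (by fun_prop) ?_
    refine continuousOn_finsetSum _ fun i _ => ?_
    refine ContinuousOn.mul (by fun_prop) ?_
    exact (hh i).comp (by fun_prop) fun q hq => hq.2 i (Set.mem_univ i)
  convert h1.image_of_continuousOn h2 using 1
  ext q
  constructor
  · rintro ⟨p, hp, hp1, rfl⟩
    choose t ht x hx hpx using hp
    refine ⟨(t, x), ⟨⟨ht, ?_⟩, fun i _ => hx i⟩, ?_⟩
    · simpa [hpx] using hp1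
    · simp [hpx, coneExtend_smul]
  · rintro ⟨⟨t, x⟩, ⟨⟨ht, ht1⟩, hx⟩, rfl⟩
    refine ⟨fun i => (t i • x i, t i), fun i => mem_coneOver_smul (hx i (Set.mem_univ i)) (ht i),
      ht1, ?_⟩
    simp [coneExtend_smul]

end GraphHull

/-! ### Strict affine interpolation. -/

section Interpolation

variable {E : Type*} [AddCommGroup E] [Module ℝ E] [TopologicalSpace E]

/-- The space of functions that are continuous and affine on `S`. -/
def continuousAffineOn (S : Set E) : Submodule ℝ (E → ℝ) where
  carrier := {f | ContinuousOn f S ∧ IsAffineOn S f}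
  zero_mem' := ⟨continuousOn_const, fun x _ y _ s t _ _ _ => by simp⟩
  add_mem' := by
    rintro f g ⟨hf, hf'⟩ ⟨hg, hg'⟩
    refine ⟨hf.add hg, fun x hx y hy s t hs ht hst => ?_⟩
    simp only [Pi.add_apply, hf' x hx y hy s t hs ht hst, hg' x hx y hy s t hs ht hst]
    ring
  smul_mem' := by
    rintro c f ⟨hf, hf'⟩
    refine ⟨hf.const_smul c, fun x hx y hy s t hs ht hst => ?_⟩
    simp only [Pi.smul_apply, smul_eq_mul, hf' x hx y hy s t hs ht hst]
    ring

theorem const_mem_continuousAffineOn (S : Set E) (c : ℝ) :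
    (fun _ => c) ∈ continuousAffineOn S := by
  refine ⟨continuousOn_const, fun x _ y _ s t _ _ hst => ?_⟩
  rw [← add_mul, hst, one_mul]

variable {S : Set E} {ι κ : Type*} [Fintype ι] [Fintype κ]

theorem exists_abs_le_of_mem_continuousAffineOn (hS : IsCompact S) (hne : S.Nonempty)
    {h : ι → E → ℝ} (hh : ∀ i, h i ∈ continuousAffineOn S) :
    ∃ M, 0 ≤ M ∧ ∀ i, ∀ x ∈ S, |h i x| ≤ M := by
  choose C hC using fun i => hS.exists_bound_of_continuousOn (hh i).1
  obtain ⟨x₀, hx₀⟩ := hne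
  have hC0 : ∀ i, 0 ≤ C i := fun i => (norm_nonneg _).trans (hC i x₀ hx₀)
  exact ⟨∑ i, C i, Finset.sum_nonneg fun i _ => hC0 i, fun i x hx =>
    (hC i x hx).trans (Finset.single_le_sum (fun i _ => hC0 i) (Finset.mem_univ i))⟩

/-- A point of the hull of the upper graphs lies strictly above every point of the hull of the
lower graphs in the same fibre. -/
theorem IsChoquetSimplex.snd_lt_snd_of_mem_graphHull (hS : IsChoquetSimplex S)
    (hne : S.Nonempty) {a : ι → E → ℝ} {b : κ → E → ℝ}
    (ha : ∀ i, IsAffineOn S (a i)) (hb : ∀ j, IsAffineOn S (b j))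
    (hab : ∀ i j, ∀ x ∈ S, a i x < b j x) {p q : E × ℝ} (hp : p ∈ graphHull S a)
    (hq : q ∈ graphHull S b) (hpq : p.1 = q.1) : p.2 < q.2 := by
  obtain ⟨u, hu, hu1, rfl⟩ := hp
  obtain ⟨v, hv, hv1, rfl⟩ := hq
  have huv : ∑ i, u i = ∑ j, v j := by
    ext
    · simpa [Prod.fst_sum] using hpq
    · simp [Prod.snd_sum, hu1, hv1]
  -- A common refinement of the two decompositions lets `a i` and `b j` be compared on the same
  -- piece `c i j`. The total mass is `1`, so some piece is nonzero and makes the inequality strict.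
  obtain ⟨c, hc, hcu, hcv⟩ := (hS.hasRieszDecomposition hne).exists_refinement
    (fun x hx hx' => eq_zero_of_mem_coneOver_of_neg_mem hx hx') Finset.univ Finset.univ u v
    (fun i _ => hu i) (fun j _ => hv j) huv
  replace hc : ∀ i j, c i j ∈ coneOver S := fun i j => hc i (by simp) j (by simp)
  have e1 : ∑ i, coneExtend (a i) (u i) = ∑ i, ∑ j, coneExtend (a i) (c i j) :=
    Finset.sum_congr rfl fun i _ => by
      rw [← hcu i (by simp), coneExtend_sum (ha i) hS.convex hne _ _ fun j _ => hc i j]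
  have e2 : ∑ j, coneExtend (b j) (v j) = ∑ i, ∑ j, coneExtend (b j) (c i j) := by
    rw [Finset.sum_comm]
    exact Finset.sum_congr rfl fun j _ => by
      rw [← hcv j (by simp), coneExtend_sum (hb j) hS.convex hne _ _ fun i _ => hc i j]
  have e3 : ∑ i, ∑ j, (c i j).2 = 1 := by
    rw [← hu1]
    exact Finset.sum_congr rfl fun i _ => by rw [← hcu i (by simp), Prod.snd_sum]
  have hle : ∀ i j, coneExtend (a i) (c i j) ≤ coneExtend (b j) (c i j) := fun i j => by
    obtain ⟨t, ht, x, hx, h⟩ := hc i j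
    rw [h, coneExtend_smul, coneExtend_smul]
    exact mul_le_mul_of_nonneg_left (hab i j x hx).le ht
  have hex : ∃ i j, 0 < (c i j).2 := by
    by_contra! h
    have : ∑ i, ∑ j, (c i j).2 ≤ 0 :=
      Finset.sum_nonpos fun i _ => Finset.sum_nonpos fun j _ => h i j
    linarith
  obtain ⟨i, j, hij⟩ := hex
  have hlt : coneExtend (a i) (c i j) < coneExtend (b j) (c i j) := by
    obtain ⟨t, ht, x, hx, h⟩ := hc i j
    rw [h] at hij ⊢
    rw [coneExtend_smul, coneExtend_smul]
    exact mul_lt_mul_of_pos_left (hab i j x hx) hij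
  change ∑ i, coneExtend (a i) (u i) < ∑ j, coneExtend (b j) (v j)
  rw [e1, e2]
  exact Finset.sum_lt_sum (fun i _ => Finset.sum_le_sum fun j _ => hle i j)
    ⟨i, by simp, Finset.sum_lt_sum (fun j _ => hle i j) ⟨j, by simp, hlt⟩⟩

variable [IsTopologicalAddGroup E] [ContinuousSMul ℝ E] [LocallyConvexSpace ℝ E] [T2Space E]

theorem IsChoquetSimplex.exists_between_of_nonempty (hS : IsChoquetSimplex S)
    (hne : S.Nonempty) [Nonempty ι] [Nonempty κ] {a : ι → E → ℝ} {b : κ → E → ℝ}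
    (ha : ∀ i, a i ∈ continuousAffineOn S) (hb : ∀ j, b j ∈ continuousAffineOn S)
    (hab : ∀ i j, ∀ x ∈ S, a i x < b j x) :
    ∃ c ∈ continuousAffineOn S, (∀ i, ∀ x ∈ S, a i x < c x) ∧ ∀ j, ∀ x ∈ S, c x < b j x := by
  have hA := isCompact_graphHull hS.isCompact fun i => (ha i).1
  have hB := isCompact_graphHull hS.isCompact fun j => (hb j).1
  have hA' := convex_graphHull hS.convex fun i => (ha i).2
  have hB' := convex_graphHull hS.convex fun j => (hb j).2
  have hdisj : Disjoint (({0} : Set E) ×ˢ Set.Iic (0 : ℝ)) (graphHull S b - graphHull S a) := by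
    rw [Set.disjoint_left]
    rintro _ ⟨h1, h2⟩ ⟨q, hq, p, hp, rfl⟩
    have := hS.snd_lt_snd_of_mem_graphHull hne (fun i => (ha i).2) (fun j => (hb j).2) hab hp hq
      (sub_eq_zero.1 h1).symm
    exact absurd h2 (by simpa using this)
  -- The gap `v > 0` is uniform over all pairs of points of the two hulls. The interpolant's graph
  -- will be a level set of `L` in the middle of this gap.
  obtain ⟨L, u, v, hu, huv, hv⟩ := geometric_hahn_banach_closed_compact
    ((convex_singleton (0 : E)).prod (convex_Iic (0 : ℝ))) (isClosed_singleton.prod isClosed_Iic)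
    (hB'.sub hA') (sub_eq_add_neg (graphHull S b) _ ▸ hB.add hA.neg) hdisj
  have hu0 : 0 < u := by simpa using hu 0 ⟨rfl, le_refl (0 : ℝ)⟩
  have hL : ∀ (x : E) (r : ℝ), L (x, r) = L (x, 0) + r * L (0, 1) := fun x r => by
    rw [← smul_eq_mul, ← map_smul, ← map_add]
    simp
  have hgap : ∀ i j, ∀ x ∈ S, ∀ y ∈ S, v + L (y, a i y) < L (x, b j x) := fun i j x hx y hy => by
    have := hv _ ⟨_, mem_graphHull (h := b) hx j, _, mem_graphHull (h := a) hy i, rfl⟩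
    rw [map_sub] at this
    linarith
  obtain ⟨x₀, hx₀⟩ := hne
  obtain ⟨i₀⟩ := ‹Nonempty ι›
  obtain ⟨j₀⟩ := ‹Nonempty κ›
  have hpos : 0 < L (0, 1) := by
    have h1 := hgap i₀ j₀ x₀ hx₀ x₀ hx₀
    rw [hL, hL x₀ (b j₀ x₀)] at h1
    have h2 := hab i₀ j₀ x₀ hx₀
    have h3 : 0 < (b j₀ x₀ - a i₀ x₀) * L (0, 1) := by linarith
    exact (pos_iff_pos_of_mul_pos h3).1 (sub_pos.2 h2)
  set T : Set ℝ := {r | ∃ i, ∃ y ∈ S, r = L (y, a i y)} with hT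
  have hTne : T.Nonempty := ⟨_, i₀, x₀, hx₀, rfl⟩
  have hTle : ∀ j, ∀ x ∈ S, ∀ r ∈ T, r ≤ L (x, b j x) - v := by
    rintro j x hx _ ⟨i, y, hy, rfl⟩
    linarith [hgap i j x hx y hy]
  have hbdd : BddAbove T := ⟨_, hTle j₀ x₀ hx₀⟩
  have k1 : ∀ i, ∀ y ∈ S, L (y, a i y) ≤ sSup T := fun i y hy => le_csSup hbdd ⟨i, y, hy, rfl⟩
  have k2 : ∀ j, ∀ x ∈ S, sSup T ≤ L (x, b j x) - v := fun j x hx => csSup_le hTne (hTle j x hx)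
  have hv0 : 0 < v := hu0.trans huv
  refine ⟨fun x => (sSup T + v / 2 - L (x, 0)) / L (0, 1), ⟨?_, ?_⟩, ?_, ?_⟩
  · exact Continuous.continuousOn (by fun_prop)
  · intro x _ y _ s t _ _ hst
    have : L (s • x + t • y, (0 : ℝ)) = s * L (x, 0) + t * L (y, 0) := by
      rw [← smul_eq_mul, ← smul_eq_mul, ← map_smul, ← map_smul, ← map_add]
      simp
    simp only [this]
    obtain rfl : t = 1 - s := by linarith
    field_simp
    ring
  · intro i x hx
    have := k1 i x hx
    rw [hL] at this
    rw [lt_div_iff₀ hpos]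
    linarith
  · intro j x hx
    have := k2 j x hx
    rw [hL] at this
    rw [div_lt_iff₀ hpos]
    linarith

/-- Strict interpolation for finite families of continuous affine functions on a simplex. -/
theorem IsChoquetSimplex.exists_between (hS : IsChoquetSimplex S) (hne : S.Nonempty)
    {a : ι → E → ℝ} {b : κ → E → ℝ}
    (ha : ∀ i, a i ∈ continuousAffineOn S) (hb : ∀ j, b j ∈ continuousAffineOn S)
    (hab : ∀ i j, ∀ x ∈ S, a i x < b j x) :
    ∃ c ∈ continuousAffineOn S, (∀ i, ∀ x ∈ S, a i x < c x) ∧ ∀ j, ∀ x ∈ S, c x < b j x := by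
  obtain ⟨M, hM, hMa⟩ := exists_abs_le_of_mem_continuousAffineOn hS.isCompact hne ha
  obtain ⟨N, hN, hNb⟩ := exists_abs_le_of_mem_continuousAffineOn hS.isCompact hne hb
  -- The constants `∓(M + N + 1)` make both families nonempty without breaking any strict
  -- inequality.
  obtain ⟨c, hc, hc1, hc2⟩ := hS.exists_between_of_nonempty hne
    (a := fun i : Option ι => i.elim (fun _ => -(M + N + 1)) a)
    (b := fun j : Option κ => j.elim (fun _ => M + N + 1) b)
    (by rintro (_ | i); exacts [const_mem_continuousAffineOn S _, ha i])
    (by rintro (_ | j); exacts [const_mem_continuousAffineOn S _, hb j])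
    (by
      rintro (_ | i) (_ | j) x hx
      · simp only [Option.elim]; linarith
      · have := neg_abs_le (b j x)
        have := hNb j x hx
        simp only [Option.elim]; linarith
      · have := le_abs_self (a i x)
        have := hMa i x hx
        simp only [Option.elim]; linarith
      · exact hab i j x hx)
  exact ⟨c, hc, fun i => hc1 (some i), fun j => hc2 (some j)⟩

end Interpolation

/-! ### Affine solutions of finite systems. -/

section Selection

variable {E : Type*} [AddCommGroup E] [Module ℝ E] [TopologicalSpace E]
  [IsTopologicalAddGroup E] [ContinuousSMul ℝ E] [LocallyConvexSpace ℝ E] [T2Space E] {S : Set E}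

/-- A finite system of strict linear inequalities with continuous affine right-hand sides that is
solvable at every point of a simplex has a continuous affine solution. -/
theorem IsChoquetSimplex.exists_affine_solution (hS : IsChoquetSimplex S) (hne : S.Nonempty)
    (n : ℕ) {ι : Type} [Fintype ι] (r : ι → Fin n → ℝ) (h : ι → E → ℝ)
    (hh : ∀ i, h i ∈ continuousAffineOn S)
    (hsol : ∀ y ∈ S, ∃ t : Fin n → ℝ, ∀ i, 0 < ∑ j, r i j * t j + h i y) :
    ∃ g : Fin n → E → ℝ, (∀ j, g j ∈ continuousAffineOn S) ∧
      ∀ i, ∀ y ∈ S, 0 < ∑ j, r i j * g j y + h i y := by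
  classical
  induction n generalizing ι with
  | zero =>
    refine ⟨Fin.elim0, fun j => j.elim0, fun i y hy => ?_⟩
    obtain ⟨t, ht⟩ := hsol y hy
    simpa using ht i
  | succ n ih =>
    -- Solved for the first unknown, rows in `P` are lower bounds, rows in `Q` upper bounds, and
    -- rows in `Z` do not involve it. Each pair in `P × Q` contributes the condition lower < upper.
    let P := {i // 0 < r i 0}
    let Q := {i // r i 0 < 0}
    let Z := {i // r i 0 = 0}
    -- eliminate the first unknown
    let r' : Z ⊕ P × Q → Fin n → ℝ := Sum.elim (fun i j => r i j.succ)
      fun pq j => (r pq.1 0)⁻¹ * r pq.1 j.succ - (r pq.2 0)⁻¹ * r pq.2 j.succ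
    let h' : Z ⊕ P × Q → E → ℝ := Sum.elim (fun i => h i)
      fun pq => (r pq.1 0)⁻¹ • h pq.1 - (r pq.2 0)⁻¹ • h pq.2
    have hpq : ∀ (p : P) (q : Q) (t : Fin n → ℝ) (y : E),
        ∑ j, r' (.inr (p, q)) j * t j + h' (.inr (p, q)) y =
        (r p 0)⁻¹ * (∑ j, r p j.succ * t j + h p y) -
          (r q 0)⁻¹ * (∑ j, r q j.succ * t j + h q y) := by
      intro p q t y
      simp only [r', h', Sum.elim_inr, sub_mul, Finset.sum_sub_distrib, mul_add, Finset.mul_sum,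
        Pi.sub_apply, Pi.smul_apply, smul_eq_mul, mul_assoc]
      ring
    obtain ⟨g, hg, hgs⟩ := ih r' h' (by
      rintro (i | ⟨p, q⟩)
      · exact hh i
      · exact Submodule.sub_mem _ (Submodule.smul_mem _ _ (hh _)) (Submodule.smul_mem _ _ (hh _)))
      (by
        intro y hy
        obtain ⟨t, ht⟩ := hsol y hy
        refine ⟨fun j => t j.succ, ?_⟩
        rintro (⟨i, hi⟩ | ⟨p, q⟩)
        · have := ht i
          rw [Fin.sum_univ_succ, hi] at this
          simpa [r', h'] using this
        · rw [hpq]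
          have hp := mul_pos (inv_pos.2 p.2) (ht p)
          have hq := mul_neg_of_neg_of_pos (inv_lt_zero.2 q.2) (ht q)
          rw [Fin.sum_univ_succ, add_assoc, mul_add, inv_mul_cancel_left₀ p.2.ne'] at hp
          rw [Fin.sum_univ_succ, add_assoc, mul_add, inv_mul_cancel_left₀ q.2.ne] at hq
          linarith)
    have hb : ∀ i, (-(r i 0)⁻¹) • (∑ j : Fin n, r i j.succ • g j + h i) ∈
        continuousAffineOn S := fun i => Submodule.smul_mem _ _ (Submodule.add_mem _
      (Submodule.sum_mem _ fun j _ => Submodule.smul_mem _ _ (hg j)) (hh i))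
    have hval : ∀ i y, ((-(r i 0)⁻¹) • (∑ j : Fin n, r i j.succ • g j + h i)) y =
        -((r i 0)⁻¹ * (∑ j : Fin n, r i j.succ * g j y + h i y)) := by
      intro i y
      simp [Finset.sum_apply]
    -- Back-substitution: the first unknown is interpolated between its affine bounds.
    obtain ⟨c, hc, hc1, hc2⟩ := hS.exists_between hne
      (a := fun p : P => (-(r p 0)⁻¹) • (∑ j : Fin n, r p j.succ • g j + h p))
      (b := fun q : Q => (-(r q 0)⁻¹) • (∑ j : Fin n, r q j.succ • g j + h q))
      (fun p => hb p) (fun q => hb q) (by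
        intro p q y hy
        have := hgs (.inr (p, q)) y hy
        rw [hpq p q (fun j => g j y)] at this
        rw [hval, hval]
        linarith)
    refine ⟨Fin.cons c g, fun j => Fin.cases hc hg j, fun i y hy => ?_⟩
    rw [Fin.sum_univ_succ, add_assoc]
    simp only [Fin.cons_zero, Fin.cons_succ]
    rcases lt_trichotomy (r i 0) 0 with hi | hi | hi
    · have := hc2 ⟨i, hi⟩ y hy
      rw [hval, lt_neg, ← neg_mul_neg] at this
      have h2 := mul_lt_mul_of_neg_left this hi
      rw [neg_mul_neg, mul_inv_cancel_left₀ hi.ne] at h2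
      linarith
    · have := hgs (.inl ⟨i, hi⟩) y hy
      simpa [hi, r', h'] using this
    · have := hc1 ⟨i, hi⟩ y hy
      rw [hval, neg_lt] at this
      have h2 := mul_lt_mul_of_pos_left this hi
      rw [mul_inv_cancel_left₀ hi.ne'] at h2
      linarith

end Selection

/-! ### Finite nets and sampling. -/

section Approximation

/-- A continuous function on a product of compact sets has finite nets in the second variable,
uniformly in the first. -/
theorem exists_finite_net_of_continuousOn_prod {X Y : Type*} [TopologicalSpace X]
    [TopologicalSpace Y] {A : Set X} {B : Set Y} (hA : IsCompact A) (hB : IsCompact B)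
    {G : X → Y → ℝ} (hG : ContinuousOn (fun p : X × Y => G p.1 p.2) (A ×ˢ B)) {η : ℝ}
    (hη : 0 < η) :
    ∃ (n : ℕ) (v : Fin n → Y), (∀ j, v j ∈ B) ∧
      ∀ y ∈ B, ∃ j, ∀ x ∈ A, |G x y - G x (v j)| < η := by
  have := isCompact_iff_compactSpace.1 hA
  have := isCompact_iff_compactSpace.1 hB
  let H : C(B × A, ℝ) := ⟨fun p => G p.2 p.1, hG.comp_continuous
    (f := fun p : B × A => ((p.2 : X), (p.1 : Y))) (by fun_prop) fun p => ⟨p.2.2, p.1.2⟩⟩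
  -- As a map into `C(A, ℝ)` with the sup norm, continuity in `y` is uniform in `x`.
  let Φ : C(B, C(A, ℝ)) := H.curry
  obtain ⟨t, ht⟩ := CompactSpace.elim_nhds_subcover (fun y => Φ ⁻¹' Metric.ball (Φ y) η)
    fun y => Φ.continuous.continuousAt (Metric.ball_mem_nhds _ hη)
  refine ⟨t.card, fun j => (t.equivFin.symm j : B), fun j => Subtype.coe_prop _, fun y hy => ?_⟩
  have hmem : (⟨y, hy⟩ : B) ∈ ⋃ z ∈ t, Φ ⁻¹' Metric.ball (Φ z) η := ht ▸ trivial
  simp only [Set.mem_iUnion, Set.mem_preimage, Metric.mem_ball] at hmem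
  obtain ⟨z, hz, hd⟩ := hmem
  refine ⟨t.equivFin ⟨z, hz⟩, fun x hx => ?_⟩
  have := (ContinuousMap.dist_lt_iff hη).1 hd ⟨x, hx⟩
  simpa [Φ, H, Real.dist_eq] using this

variable {E : Type*} [AddCommGroup E] [Module ℝ E] [TopologicalSpace E]
  [IsTopologicalAddGroup E] [ContinuousSMul ℝ E] [LocallyConvexSpace ℝ E] [T2Space E] {S : Set E}

/-- A family of continuous affine functions on a simplex, continuously indexed by a compact set,
is uniformly approximated by sampling against finitely many positive continuous affine
functions. -/
theorem IsChoquetSimplex.exists_sampling (hS : IsChoquetSimplex S) (hne : S.Nonempty)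
    {X : Type*} [TopologicalSpace X] {A : Set X} (hA : IsCompact A) {G : X → E → ℝ}
    (hG : ContinuousOn (fun p : X × E => G p.1 p.2) (A ×ˢ S))
    (haff : ∀ x ∈ A, IsAffineOn S (G x)) {ε : ℝ} (hε : 0 < ε) :
    ∃ (n : ℕ) (v : Fin n → E) (g : Fin n → E → ℝ), (∀ j, v j ∈ S) ∧
      (∀ j, g j ∈ continuousAffineOn S) ∧ (∀ j, ∀ y ∈ S, 0 < g j y) ∧
      (∀ y ∈ S, ∑ j, g j y < 2) ∧
      ∀ x ∈ A, ∀ y ∈ S, |G x y - ∑ j, G x (v j) * g j y| < ε := by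
  obtain ⟨M, hM⟩ := (hA.prod hS.isCompact).exists_bound_of_continuousOn hG
  replace hM : ∀ x ∈ A, ∀ y ∈ S, |G x y| ≤ |M| := fun x hx y hy =>
    (hM (x, y) ⟨hx, hy⟩).trans (le_abs_self M)
  set η := ε / 8 with hηdef
  have hη : 0 < η := by positivity
  obtain ⟨n, v, hv, hvnet⟩ := exists_finite_net_of_continuousOn_prod hA hS.isCompact hG hη
  obtain ⟨p, w, hw, hwnet⟩ := exists_finite_net_of_continuousOn_prod hS.isCompact hA
    (G := fun y x => G x y) (hG.comp (f := Prod.swap) continuous_swap.continuousOn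
      fun q hq => ⟨hq.2, hq.1⟩) hη
  have hGw : ∀ l, G (w l) ∈ continuousAffineOn S := fun l =>
    ⟨hG.comp (f := fun y => (w l, y)) (by fun_prop) fun y hy => ⟨hw l, hy⟩, haff _ (hw l)⟩
  -- The rows encode `t j > 0`, `∑ t j < 2`, and the two sides of the sampling estimate at each net
  -- point `w l`.
  let r : (Fin n ⊕ Unit) ⊕ (Fin p ⊕ Fin p) → Fin n → ℝ := Sum.elim
    (Sum.elim (fun i => Pi.single i 1) fun _ _ => -1)
    (Sum.elim (fun l j => G (w l) (v j)) fun l j => -G (w l) (v j))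
  let h : (Fin n ⊕ Unit) ⊕ (Fin p ⊕ Fin p) → E → ℝ := Sum.elim
    (Sum.elim (fun _ _ => 0) fun _ _ => 2)
    (Sum.elim (fun l => (-1 : ℝ) • G (w l) + fun _ => 2 * η) fun l => G (w l) + fun _ => 2 * η)
  have hrh : ∀ (t : Fin n → ℝ) (y : E), (∀ i, 0 < ∑ j, r i j * t j + h i y) ↔
      (∀ j, 0 < t j) ∧ ∑ j, t j < 2 ∧
        ∀ l, |G (w l) y - ∑ j, G (w l) (v j) * t j| < 2 * η := by
    intro t y
    simp only [Sum.forall, r, h, Sum.elim_inl, Sum.elim_inr, abs_lt, forall_const, Pi.add_apply,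
      Pi.smul_apply, smul_eq_mul, neg_mul, Finset.sum_neg_distrib, one_mul, add_zero,
      Pi.single_apply, ite_mul, zero_mul, Finset.sum_ite_eq',
      Finset.mem_univ, if_true, and_assoc, ← forall_and]
    refine and_congr Iff.rfl (and_congr ⟨fun h => by linarith, fun h => by linarith⟩
      (forall_congr' fun l => ⟨fun h => ?_, fun h => ?_⟩)) <;>
    constructor <;> linarith [h.1, h.2]
  obtain ⟨g, hg, hgs⟩ := hS.exists_affine_solution hne n r h (by
      rintro ((j | _) | (l | l))
      · exact const_mem_continuousAffineOn S 0
      · exact const_mem_continuousAffineOn S 2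
      · exact Submodule.add_mem _ (Submodule.smul_mem _ _ (hGw l))
          (const_mem_continuousAffineOn S _)
      · exact Submodule.add_mem _ (hGw l) (const_mem_continuousAffineOn S _))
    (by
      intro y hy
      obtain ⟨j₀, hj₀⟩ := hvnet y hy
      -- The point mass at `v j₀` is spread by `τ` so that every weight is positive; `τ` keeps the
      -- total below `2` and the added error below `η`.
      set τ : ℝ := min 1 η / ((n + 1) * (|M| + 1)) with hτdef
      have hτ : 0 < τ := by positivity
      have hτn : τ * n * (|M| + 1) < min 1 η := by
        have : τ * (n + 1) * (|M| + 1) = min 1 η := by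
          rw [hτdef]
          field_simp
        rw [← this]
        have : 0 < |M| + 1 := by positivity
        nlinarith [mul_pos hτ this]
      have hτM : τ * n * |M| < η := by
        have := min_le_right 1 η
        have : 0 ≤ τ * n := by positivity
        linarith
      have hτ1 : τ * n < 1 := by
        have := min_le_left 1 η
        have : 0 ≤ τ * n * |M| := by positivity
        linarith
      refine ⟨fun j => τ + (Pi.single j₀ (1 : ℝ) : Fin n → ℝ) j, (hrh _ y).2 ⟨fun j => ?_, ?_,
        fun l => ?_⟩⟩
      · have : 0 ≤ (Pi.single j₀ (1 : ℝ) : Fin n → ℝ) j := by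
          rcases eq_or_ne j j₀ with rfl | hj <;> simp [*]
        linarith
      · simp only [Finset.sum_add_distrib, Finset.sum_const, Finset.card_univ, Fintype.card_fin,
          nsmul_eq_mul, Finset.sum_pi_single', Finset.mem_univ, if_true]
        linarith
      · have e : ∑ j, G (w l) (v j) * (τ + (Pi.single j₀ (1 : ℝ) : Fin n → ℝ) j) =
            ∑ j, G (w l) (v j) * τ + G (w l) (v j₀) := by
          simp [mul_add, Finset.sum_add_distrib, Pi.single_apply]
        have hs : |∑ j, G (w l) (v j) * τ| ≤ τ * n * |M| := by
          refine (Finset.abs_sum_le_sum_abs _ _).trans ?_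
          have : ∀ j ∈ Finset.univ, |G (w l) (v j) * τ| ≤ |M| * τ := fun j _ => by
            rw [abs_mul, abs_of_pos hτ]
            exact mul_le_mul_of_nonneg_right (hM _ (hw l) _ (hv j)) hτ.le
          refine (Finset.sum_le_sum this).trans (le_of_eq ?_)
          simp
          ring
        rw [e]
        have h1 := abs_lt.1 (hj₀ (w l) (hw l))
        have h2 := abs_le.1 hs
        rw [abs_lt]
        constructor <;> linarith [h1.1, h1.2, h2.1, h2.2])
  have key := fun y hy => (hrh (fun j => g j y) y).1 fun i => hgs i y hy
  refine ⟨n, v, g, hv, hg, fun j y hy => (key y hy).1 j, fun y hy => (key y hy).2.1,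
    fun x hx y hy => ?_⟩
  obtain ⟨hpos, hsum, hnet⟩ := key y hy
  obtain ⟨l, hl⟩ := hwnet x hx
  have h1 := abs_lt.1 (hl y hy)
  have h2 := abs_lt.1 (hnet l)
  -- Passing from `w l` to `x` costs at most `η * 2` here, by the bound on `∑ g j`. The total error
  -- is below `η + 2 * η + 2 * η < ε`.
  have h3 : |∑ j, G x (v j) * g j y - ∑ j, G (w l) (v j) * g j y| ≤ η * 2 := by
    rw [← Finset.sum_sub_distrib]
    refine (Finset.abs_sum_le_sum_abs _ _).trans ?_
    have : ∀ j ∈ Finset.univ, |G x (v j) * g j y - G (w l) (v j) * g j y| ≤ η * g j y :=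
      fun j _ => by
        rw [← sub_mul, abs_mul, abs_of_pos (hpos j)]
        exact mul_le_mul_of_nonneg_right (hl (v j) (hv j)).le (hpos j).le
    refine (Finset.sum_le_sum this).trans ?_
    rw [← Finset.mul_sum]
    exact mul_le_mul_of_nonneg_left hsum.le hη.le
  have h4 := abs_le.1 h3
  rw [abs_lt]
  constructor <;> linarith [h1.1, h1.2, h2.1, h2.2, h4.1, h4.2]

end Approximation

/-! ### Approximation from below. -/

theorem mainTheorem7 {E₁ E₂ : Type*}
    [AddCommGroup E₁] [Module ℝ E₁] [TopologicalSpace E₁] [IsTopologicalAddGroup E₁]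
    [ContinuousSMul ℝ E₁] [LocallyConvexSpace ℝ E₁] [T2Space E₁]
    [AddCommGroup E₂] [Module ℝ E₂] [TopologicalSpace E₂] [IsTopologicalAddGroup E₂]
    [ContinuousSMul ℝ E₂] [LocallyConvexSpace ℝ E₂] [T2Space E₂]
    (S₁ : Set E₁) (S₂ : Set E₂)
    (hS₁ : IsChoquetSimplex S₁) (hS₂ : IsChoquetSimplex S₂)
    (hm₁ : TopologicalSpace.MetrizableSpace S₁) (hm₂ : TopologicalSpace.MetrizableSpace S₂)
    (F : E₁ × E₂ → ℝ)
    (hFcont : ContinuousOn F (S₁ ×ˢ S₂))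
    (hFpos : ∀ x ∈ S₁, ∀ y ∈ S₂, 0 < F (x, y))
    (hFaff₁ : ∀ y ∈ S₂, IsAffineOn S₁ (fun x => F (x, y)))
    (hFaff₂ : ∀ x ∈ S₁, IsAffineOn S₂ (fun y => F (x, y)))
    (ε : ℝ) (hε : 0 < ε) :
    ∃ (m n : ℕ) (a : Fin m → Fin n → ℝ) (f : Fin m → E₁ → ℝ) (g : Fin n → E₂ → ℝ),
      (∀ i j, 0 < a i j) ∧
      (∀ i, ContinuousOn (f i) S₁ ∧ IsAffineOn S₁ (f i) ∧ ∀ x ∈ S₁, 0 < f i x) ∧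
      (∀ j, ContinuousOn (g j) S₂ ∧ IsAffineOn S₂ (g j) ∧ ∀ y ∈ S₂, 0 < g j y) ∧
      ∀ x ∈ S₁, ∀ y ∈ S₂,
        ∑ i, ∑ j, a i j * f i x * g j y ≤ F (x, y) ∧
        F (x, y) - ∑ i, ∑ j, a i j * f i x * g j y < ε := by
  rcases (S₁ ×ˢ S₂).eq_empty_or_nonempty with hemp | hne
  · exact ⟨0, 0, 0, Fin.elim0, Fin.elim0, fun i => i.elim0, fun i => i.elim0, fun i => i.elim0,
      fun x hx y hy => absurd (hemp ▸ Set.mk_mem_prod hx hy) (Set.notMem_empty _)⟩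
  obtain ⟨z, hz, hzmin⟩ := (hS₁.isCompact.prod hS₂.isCompact).exists_isMinOn hne hFcont
  obtain ⟨C, hC⟩ := (hS₁.isCompact.prod hS₂.isCompact).exists_bound_of_continuousOn hFcont
  have hδ : 0 < F z := hFpos z.1 hz.1 z.2 hz.2
  set θ := min ε (F z) / 2 with hθdef
  have hθ : 0 < θ := by positivity
  have hθε : 2 * θ ≤ ε := by linarith [min_le_left ε (F z)]
  have hθF : ∀ x ∈ S₁, ∀ y ∈ S₂, θ < F (x, y) := fun x hx y hy => by
    have : F z ≤ F (x, y) := hzmin (Set.mk_mem_prod hx hy)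
    linarith [min_le_right ε (F z)]
  have haffsub : ∀ x ∈ S₁, IsAffineOn S₂ (fun y => F (x, y) - θ) :=
    fun x hx y hy y' hy' s t hs ht hst => by
      simp only [hFaff₂ x hx y hy y' hy' s t hs ht hst]
      linear_combination θ * hst
  obtain ⟨n, v, g, hv, hg, hgpos, hgsum, happ⟩ := hS₂.exists_sampling hne.snd hS₁.isCompact
    (G := fun x y => F (x, y) - θ) (hFcont.sub continuousOn_const) haffsub (half_pos hθ)
  have hC0 : 0 < C := hδ.trans_le ((le_abs_self _).trans (hC z hz))
  -- Chosen so that adding `τ` to every entry of the identity matrix, to make all coefficients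
  -- positive, raises the sum by at most `θ / 2`. With sampling error below `θ / 2`, the sum stays
  -- between `F - 2 * θ` and `F`.
  set τ : ℝ := θ / (4 * ((n + 1) * C)) with hτdef
  have hτ : 0 < τ := by positivity
  have hf : ∀ i, ∀ x ∈ S₁, 0 < F (x, v i) - θ := fun i x hx => sub_pos.2 (hθF x hx _ (hv i))
  refine ⟨n, n, fun i j => τ + if i = j then 1 else 0, fun i x => F (x, v i) - θ, g,
    fun i j => ?_, fun i => ⟨?_, ?_, hf i⟩, fun j => ⟨(hg j).1, (hg j).2, hgpos j⟩,
    fun x hx y hy => ?_⟩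
  · dsimp only
    split_ifs <;> positivity
  · exact (hFcont.comp (f := fun x => (x, v i)) (by fun_prop)
      fun x hx => ⟨hx, hv i⟩).sub continuousOn_const
  · intro x hx x' hx' s t hs ht hst
    simp only [hFaff₁ _ (hv i) x hx x' hx' s t hs ht hst]
    linear_combination θ * hst
  · have e : ∑ i, ∑ j, (τ + if i = j then 1 else 0) * (F (x, v i) - θ) * g j y =
        τ * ((∑ i, (F (x, v i) - θ)) * ∑ j, g j y) + ∑ i, (F (x, v i) - θ) * g i y := by
      rw [Finset.sum_mul_sum]
      simp only [add_mul, Finset.sum_add_distrib, Finset.mul_sum, mul_assoc, ite_mul, one_mul,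
        zero_mul, Finset.sum_ite_eq, Finset.mem_univ, if_true]
    have h0 : 0 ≤ ∑ i, (F (x, v i) - θ) := Finset.sum_nonneg fun i _ => (hf i x hx).le
    have h1 : ∑ i, (F (x, v i) - θ) ≤ n * C := by
      have : ∀ i ∈ Finset.univ, F (x, v i) - θ ≤ C := fun i _ => by
        have := (le_abs_self _).trans (hC (x, v i) ⟨hx, hv i⟩)
        linarith
      simpa using Finset.sum_le_sum this
    have h2 : 0 ≤ ∑ j, g j y := Finset.sum_nonneg fun j _ => (hgpos j y hy).le
    have h3 : τ * ((∑ i, (F (x, v i) - θ)) * ∑ j, g j y) ≤ τ * (((n + 1) * C) * 2) := by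
      refine mul_le_mul_of_nonneg_left (mul_le_mul (by linarith) (hgsum y hy).le h2 ?_) hτ.le
      positivity
    have h4 : τ * (((n + 1) * C) * 2) = θ / 2 := by
      rw [hτdef]
      field_simp
      norm_num
    have h5 : 0 ≤ τ * ((∑ i, (F (x, v i) - θ)) * ∑ j, g j y) := by positivity
    have h6 := abs_lt.1 (happ x hx y hy)
    rw [e]
    constructor <;> linarith [h6.1, h6.2]
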